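/- An oriented matroid $\vec M=(E,\mathcal C)$ consists of a finite ground set $E$ and a collection $\mathcal C$ of signed circuits, i.e. pairs $(C^+,C^-)$ of disjoint subsets of $E$ satisfying the usual signed circuit axioms; the supports $C^+\cup C^-$ are the circuits of the underlying matroid $M$. Suppose that $M$ is regular, i.e. representable over every field. A circuit $C$ of $M$ is called directed if $(C,\emptyset)\in\mathcal C$ (equivalently $(\emptyset,C)\in\mathcal C$), and an oriented matroid is called totally cyclic if every element of its ground set lies in a directed circuit. The circuit space of $M$ is the subspace of $\mathbb F_2^{E}$ spanned by the incidence vectors of the circuits of $M$; a directed circuit basis of $M$ is a set of directed circuits of $\vec M$ whose incidence vectors form a basis of the circuit space. For $A\subseteq E$, let $\vec M-A$ be the deletion of $A$, i.e. the oriented matroid on $E\setminus A$ whose signed circuits are those $(C^+,C^-)\in\mathcal C$ with $(C^+\cup C^-)\cap A=\emptyset$. (1) If $\vec M$ is totally cyclic, then $M$ admits a directed circuit basis. (2) For every coindependent set $A$ of $M$ (i.e. $A$ is independent in the dual matroid $M^*$) such that $\vec M-A$ is totally cyclic, there exists a directed circuit basis of $M$ such that every $a\in A$ is contained in exactly one circuit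 of the basis. -/

import Mathlib

universe u v

/-- An oriented matroid on a finite ground set `E`, given by its signed circuits: pairs
`(C⁺, C⁻)` of disjoint subsets of `E` satisfying the signed circuit axioms. -/
structure OrientedMatroid (α : Type u) where
  /-- The ground set. -/
  E : Set α
  ground_finite : E.Finite
  /-- The collection of signed circuits. -/
  circuits : Set (Set α × Set α)
  subset_ground : ∀ X ∈ circuits, X.1 ∪ X.2 ⊆ E
  disjoint : ∀ X ∈ circuits, Disjoint X.1 X.2
  empty_notMem : ((∅, ∅) : Set α × Set α) ∉ circuits
  swap_mem : ∀ X ∈ circuits, X.swap ∈ circuits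
  incomparable : ∀ X ∈ circuits, ∀ Y ∈ circuits, X.1 ∪ X.2 ⊆ Y.1 ∪ Y.2 → X = Y ∨ X = Y.swap
  elimination : ∀ X ∈ circuits, ∀ Y ∈ circuits, X ≠ Y.swap → ∀ e ∈ X.1 ∩ Y.2,
    ∃ Z ∈ circuits, Z.1 ⊆ (X.1 ∪ Y.1) \ {e} ∧ Z.2 ⊆ (X.2 ∪ Y.2) \ {e}

namespace OrientedMatroid

/-- `C` is the support of some signed circuit. -/
def IsSupport {α : Type u} (O : OrientedMatroid α) (C : Set α) : Prop :=
  ∃ X ∈ O.circuits, X.1 ∪ X.2 = C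

/-- A subset of the ground set is independent if it contains no support of a signed circuit. -/
def IsIndep {α : Type u} (O : OrientedMatroid α) (I : Set α) : Prop :=
  I ⊆ O.E ∧ ∀ C, O.IsSupport C → ¬ C ⊆ I

theorem IsSupport.subset_ground {α : Type u} {O : OrientedMatroid α} {C : Set α}
    (h : O.IsSupport C) : C ⊆ O.E := by
  obtain ⟨X, hX, rfl⟩ := h
  exact O.subset_ground X hX

theorem IsSupport.nonempty {α : Type u} {O : OrientedMatroid α} {C : Set α}
    (h : O.IsSupport C) : C.Nonempty := by
  obtain ⟨X, hX, rfl⟩ := h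
  by_contra hne
  rw [Set.not_nonempty_iff_eq_empty, Set.union_empty_iff] at hne
  apply O.empty_notMem
  rw [← hne.1]
  nth_rewrite 2 [hne.1]
  rw [← hne.2]
  exact hX

theorem IsSupport.eq_of_subset {α : Type u} {O : OrientedMatroid α} {C D : Set α}
    (hC : O.IsSupport C) (hD : O.IsSupport D) (h : C ⊆ D) : C = D := by
  obtain ⟨X, hX, rfl⟩ := hC
  obtain ⟨Y, hY, rfl⟩ := hD
  rcases O.incomparable X hX Y hY h with rfl | rfl
  · rfl
  · simp [Set.union_comm]

/-- Weak circuit elimination for the supports. -/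
theorem IsSupport.elimination {α : Type u} {O : OrientedMatroid α} {C D : Set α}
    (hC : O.IsSupport C) (hD : O.IsSupport D) (hne : C ≠ D) {e : α} (heC : e ∈ C) (heD : e ∈ D) :
    ∃ K, O.IsSupport K ∧ K ⊆ (C ∪ D) \ {e} := by
  obtain ⟨X, hX, heX, rfl⟩ : ∃ X ∈ O.circuits, e ∈ X.1 ∧ X.1 ∪ X.2 = C := by
    obtain ⟨X, hX, rfl⟩ := hC
    rcases heC with h | h
    · exact ⟨X, hX, h, rfl⟩
    · exact ⟨X.swap, O.swap_mem X hX, h, by simp [Set.union_comm]⟩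
  obtain ⟨Y, hY, heY, rfl⟩ : ∃ Y ∈ O.circuits, e ∈ Y.2 ∧ Y.1 ∪ Y.2 = D := by
    obtain ⟨Y, hY, rfl⟩ := hD
    rcases heD with h | h
    · exact ⟨Y.swap, O.swap_mem Y hY, h, by simp [Set.union_comm]⟩
    · exact ⟨Y, hY, h, rfl⟩
  have hXY : X ≠ Y.swap := by
    rintro rfl
    exact hne (by simp [Set.union_comm])
  obtain ⟨Z, hZ, h1, h2⟩ := O.elimination X hX Y hY hXY e ⟨heX, heY⟩
  refine ⟨_, ⟨Z, hZ, rfl⟩, ?_⟩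
  rintro x (hx | hx)
  · have := h1 hx
    simp only [Set.mem_sdiff, Set.mem_union, Set.mem_singleton_iff] at this ⊢
    tauto
  · have := h2 hx
    simp only [Set.mem_sdiff, Set.mem_union, Set.mem_singleton_iff] at this ⊢
    tauto

theorem IsIndep.subset {α : Type u} {O : OrientedMatroid α} {I J : Set α}
    (hJ : O.IsIndep J) (h : I ⊆ J) : O.IsIndep I :=
  ⟨h.trans hJ.1, fun C hC hCI => hJ.2 C hC (hCI.trans h)⟩

theorem IsIndep.augment {α : Type u} {O : OrientedMatroid α} {I J : Set α}
    (hI : O.IsIndep I) (hJ : O.IsIndep J) (hlt : I.ncard < J.ncard) :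
    ∃ e ∈ J, e ∉ I ∧ O.IsIndep (insert e I) := by
  by_contra! hcon
  have fin : ∀ {K : Set α}, O.IsIndep K → K.Finite := fun h => O.ground_finite.subset h.1
  have hex : ∃ n, ∃ K, O.IsIndep K ∧ K ⊆ I ∪ J ∧ I.ncard < K.ncard ∧ (I \ K).ncard = n :=
    ⟨_, J, hJ, Set.subset_union_right, hlt, rfl⟩
  classical
  obtain ⟨K, hK, hKIJ, hIK, hKn⟩ := Nat.find_spec hex
  have hmin : ∀ L, O.IsIndep L → L ⊆ I ∪ J → I.ncard < L.ncard →
      (I \ K).ncard ≤ (I \ L).ncard := by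
    intro L h1 h2 h3
    rw [hKn]
    exact Nat.find_min' hex ⟨L, h1, h2, h3, rfl⟩
  obtain ⟨g, hgK, hgI⟩ : ∃ g ∈ K, g ∉ I := by
    by_contra! h
    exact absurd (Set.ncard_le_ncard h (fin hI)) (by omega)
  obtain ⟨e, heI, heK⟩ : ∃ e ∈ I, e ∉ K := by
    by_contra! h
    have hgJ : g ∈ J := (hKIJ hgK).resolve_left hgI
    exact hcon g hgJ hgI (hK.subset (Set.insert_subset hgK h))
  have key : ∀ f ∈ K, f ∉ I → ∃ C, O.IsSupport C ∧ C ⊆ insert e K ∧ f ∉ C ∧ e ∈ C := by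
    intro f hfK hfI
    have hcard : (insert e (K \ {f})).ncard = K.ncard := by
      rw [Set.ncard_insert_of_notMem (fun h => heK h.1) ((fin hK).subset Set.sdiff_subset)]
      exact Set.ncard_sdiff_singleton_add_one hfK (fin hK)
    have hsub : insert e (K \ {f}) ⊆ I ∪ J :=
      Set.insert_subset (Or.inl heI) (Set.sdiff_subset.trans hKIJ)
    have hdep : ¬ O.IsIndep (insert e (K \ {f})) := by
      intro hind
      have hle := hmin _ hind hsub (by omega)
      have hss : I \ insert e (K \ {f}) ⊂ I \ K := by
        refine ⟨fun x hx => ⟨hx.1, fun hxK => hx.2 (Or.inr ⟨hxK, ?_⟩)⟩, fun h => ?_⟩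
        · rintro rfl
          exact hfI hx.1
        · exact (h ⟨heI, heK⟩).2 (Or.inl rfl)
      exact absurd (Set.ncard_lt_ncard hss ((fin hI).subset Set.sdiff_subset)) (by omega)
    have : ∃ C, O.IsSupport C ∧ C ⊆ insert e (K \ {f}) := by
      by_contra! h
      exact hdep ⟨Set.insert_subset (hI.1 heI) (Set.sdiff_subset.trans hK.1), h⟩
    obtain ⟨C, hC, hCs⟩ := this
    refine ⟨C, hC, hCs.trans (Set.insert_subset_insert Set.sdiff_subset), fun hfC => ?_, ?_⟩
    · rcases hCs hfC with rfl | h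
      · exact heK hfK
      · exact h.2 rfl
    · by_contra heC
      refine hK.2 C hC fun x hx => ?_
      rcases hCs hx with rfl | h
      · exact absurd hx heC
      · exact h.1
  obtain ⟨C, hC, hCK, hgC, heC⟩ := key g hgK hgI
  obtain ⟨h, hhC, hhI⟩ : ∃ h ∈ C, h ∉ I := by
    by_contra! hh
    exact hI.2 C hC hh
  have hhK : h ∈ K := by
    rcases hCK hhC with rfl | h'
    · exact absurd heI hhI
    · exact h'
  obtain ⟨D, hD, hDK, hhD, heD⟩ := key h hhK hhI
  obtain ⟨Z, hZ, hZs⟩ := hC.elimination hD (fun hCD => hhD (hCD ▸ hhC)) heC heD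
  refine hK.2 Z hZ fun x hx => ?_
  obtain ⟨hx1 | hx1, hx2⟩ := hZs hx
  · exact (hCK hx1).resolve_left hx2
  · exact (hDK hx1).resolve_left hx2

/-- The underlying matroid: its circuits are the supports of the signed circuits
(see `underlying_isCircuit_iff`). -/
def underlying {α : Type u} (O : OrientedMatroid α) : Matroid α :=
  (IndepMatroid.ofFinite O.ground_finite O.IsIndep
    ⟨Set.empty_subset _, fun _ hC h => hC.nonempty.ne_empty (Set.subset_empty_iff.1 h)⟩
    (fun _ _ hJ h => hJ.subset h)
    (fun _ _ hI hJ hlt => hI.augment hJ hlt)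
    (fun _ hI => hI.1)).matroid

theorem underlying_ground {α : Type u} (O : OrientedMatroid α) : O.underlying.E = O.E := rfl

theorem underlying_indep_iff {α : Type u} (O : OrientedMatroid α) (I : Set α) :
    O.underlying.Indep I ↔ O.IsIndep I :=
  Iff.rfl

theorem underlying_isCircuit_iff {α : Type u} (O : OrientedMatroid α) (C : Set α) :
    O.underlying.IsCircuit C ↔ O.IsSupport C := by
  have hdep : ∀ D, O.underlying.Dep D ↔ D ⊆ O.E ∧ ∃ K, O.IsSupport K ∧ K ⊆ D := by
    intro D
    rw [Matroid.Dep, underlying_indep_iff, IsIndep, underlying_ground]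
    push Not
    exact ⟨fun h => ⟨h.2, h.1 h.2⟩, fun h => ⟨fun _ => h.2, h.1⟩⟩
  rw [Matroid.isCircuit_iff]
  constructor
  · rintro ⟨hC, hmin⟩
    obtain ⟨hCE, K, hK, hKC⟩ := (hdep C).1 hC
    rwa [← hmin ((hdep K).2 ⟨hKC.trans hCE, K, hK, subset_rfl⟩) hKC]
  · intro hC
    refine ⟨(hdep C).2 ⟨hC.subset_ground, C, hC, subset_rfl⟩, fun D hD hDC => ?_⟩
    obtain ⟨_, K, hK, hKD⟩ := (hdep D).1 hD
    exact hDC.antisymm ((hK.eq_of_subset hC (hKD.trans hDC)) ▸ hKD)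

/-- A set `C` is a directed circuit if `(C, ∅)` (equivalently `(∅, C)`) is a signed circuit. -/
def IsDirectedCircuit {α : Type u} (O : OrientedMatroid α) (C : Set α) : Prop :=
  ((C, ∅) : Set α × Set α) ∈ O.circuits

/-- Every element lies in a directed circuit. -/
def IsTotallyCyclic {α : Type u} (O : OrientedMatroid α) : Prop :=
  ∀ e ∈ O.E, ∃ C, O.IsDirectedCircuit C ∧ e ∈ C

/-- The deletion of a set `A` of elements: the signed circuits are those whose support
avoids `A`. -/
def delete {α : Type u} (O : OrientedMatroid α) (A : Set α) : OrientedMatroid α where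
  E := O.E \ A
  ground_finite := O.ground_finite.subset Set.sdiff_subset
  circuits := {X | X ∈ O.circuits ∧ Disjoint (X.1 ∪ X.2) A}
  subset_ground X hX := Set.subset_sdiff.2 ⟨O.subset_ground X hX.1, hX.2⟩
  disjoint X hX := O.disjoint X hX.1
  empty_notMem h := O.empty_notMem h.1
  swap_mem X hX := ⟨O.swap_mem X hX.1, by simpa [Set.union_comm] using hX.2⟩
  incomparable X hX Y hY h := O.incomparable X hX.1 Y hY.1 h
  elimination X hX Y hY hne e he := by
    obtain ⟨Z, hZ, h1, h2⟩ := O.elimination X hX.1 Y hY.1 hne e he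
    refine ⟨Z, ⟨hZ, ?_⟩, h1, h2⟩
    refine Disjoint.mono_left ?_ (hX.2.union_left hY.2)
    rintro x (hx | hx)
    · exact (h1 hx).1.imp Or.inl Or.inl
    · exact (h2 hx).1.imp Or.inr Or.inr

end OrientedMatroid

namespace Matroid

/-- `M` is representable over `F`: it is the column matroid of a matrix over `F` whose columns
are indexed by the elements of `M` (columns indexed outside the ground set play no role). -/
def IsRepresentableOver {α : Type u} (M : Matroid α) (F : Type v) [Field F] : Prop :=
  ∃ (n : ℕ) (A : Matrix (Fin n) α F), ∀ I ⊆ M.E, M.Indep I ↔ LinearIndepOn F A.col I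

/-- A regular matroid is representable over every field. -/
def IsRegular {α : Type u} (M : Matroid α) : Prop :=
  ∀ (F : Type v) [Field F], M.IsRepresentableOver F

/-- The incidence vector over `𝔽₂` of a set. A vector of `𝔽₂^E` is regarded as a vector indexed
by the ambient type that vanishes outside `E`. -/
noncomputable def incidenceVector {α : Type u} (C : Set α) : α → ZMod 2 :=
  C.indicator 1

/-- The circuit space: the `𝔽₂`-span of the incidence vectors of the circuits. -/
noncomputable def circuitSpace {α : Type u} (M : Matroid α) : Submodule (ZMod 2) (α → ZMod 2) :=
  Submodule.span (ZMod 2) (incidenceVector '' {C | M.IsCircuit C})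

/-- A circuit basis: a set of circuits whose incidence vectors form a basis of the
circuit space. -/
def IsCircuitBasis {α : Type u} (M : Matroid α) (B : Set (Set α)) : Prop :=
  (∀ C ∈ B, M.IsCircuit C) ∧
  LinearIndepOn (ZMod 2) incidenceVector B ∧
  Submodule.span (ZMod 2) (incidenceVector '' B) = M.circuitSpace

end Matroid

/-- A circuit basis of the underlying matroid is directed if all its members are directed
circuits. -/
def OrientedMatroid.IsDirectedCircuitBasis {α : Type u} (O : OrientedMatroid α)
    (B : Set (Set α)) : Prop :=
  O.underlying.IsCircuitBasis B ∧ ∀ C ∈ B, O.IsDirectedCircuit C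

/-!
An oriented matroid that is representable over `𝔽₂` has an integer flow lattice that behaves like
the cycle lattice of a graph. When two fundamental circuits of a base meet and another circuit
lies in their union, its support is their symmetric difference, so signed elimination expresses
its sign vector as an integer combination of theirs. Basis exchange then shows that the
fundamental circuits of any base generate the lattice; hence a flow is determined by its values
off a base, and the support of a nonzero flow is dependent.

It follows that a nonnegative flow is a sum of directed circuits. If the deletion of `A` is
totally cyclic, some flow vanishes on `A` and is positive on the other elements, and adding a
large multiple of it makes any flow that is nonnegative on `A` nonnegative everywhere. Applied to
a fundamental circuit of a base avoiding the coindependent set `A`, this yields for each `a ∈ A` a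
directed circuit meeting `A` exactly in `a`; applied to flows vanishing on `A`, it shows that they
are integer combinations of directed circuits avoiding `A`. Together these directed circuits
generate the flow lattice, so modulo `2` they span the circuit space. The circuits chosen for the
elements of `A` are independent there, and extending them to a basis adds only directed circuits
avoiding `A`.
-/

open scoped symmDiff

section Representable

open Function

variable {α : Type u} {M : Matroid α}

theorem linearIndepOn_col_map_of_ringEquiv {F K ι : Type*} [Field F] [Field K] (φ : F ≃+* K)
    {A : Matrix ι α F} {I : Set α} (h : LinearIndepOn F A.col I) :
    LinearIndepOn K (A.map φ).col I :=
  LinearIndependent.map_of_injective_injective h φ.symm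
    (φ.toAddEquiv.toAddMonoidHom.compLeft ι) (by simp)
    (fun m hm => funext fun i => by simpa using congrFun hm i)
    (fun r m => funext fun i => by simp)

theorem isRepresentableOver_of_ringEquiv {F K : Type*} [Field F] [Field K] (φ : F ≃+* K)
    (h : M.IsRepresentableOver F) : M.IsRepresentableOver K := by
  obtain ⟨n, A, hA⟩ := h
  refine ⟨n, A.map φ, fun I hI => (hA I hI).trans
    ⟨linearIndepOn_col_map_of_ringEquiv φ, fun hind => ?_⟩⟩
  simpa [Function.comp_def] using linearIndepOn_col_map_of_ringEquiv φ.symm hind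

theorem isRepresentableOver_zmod_two_of_isRegular (h : Matroid.IsRegular.{u, v} M) :
    M.IsRepresentableOver (ZMod 2) :=
  isRepresentableOver_of_ringEquiv ULift.ringEquiv (h (ULift.{v} (ZMod 2)))

theorem exists_linearCombination_eq_zero_of_isCircuit {F W : Type*} [Field F] [AddCommGroup W]
    [Module F W] {w : α → W} (hw : ∀ I ⊆ M.E, M.Indep I ↔ LinearIndepOn F w I) {C : Set α}
    (hC : M.IsCircuit C) : ∃ l : α →₀ F, support l = C ∧ Finsupp.linearCombination F w l = 0 := by
  have hdep : ¬ LinearIndepOn F w C := fun h => hC.not_indep ((hw C hC.subset_ground).2 h)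
  simp only [linearIndepOn_iff, not_forall] at hdep
  obtain ⟨l, hlC, hl, hl0⟩ := hdep
  rw [Finsupp.mem_supported, ← Finsupp.fun_support_eq] at hlC
  refine ⟨l, hlC.antisymm fun x hx => by_contra fun hxl => hl0 ?_, hl⟩
  have hind := (hw _ (Set.sdiff_subset.trans hC.subset_ground)).1 (hC.sdiff_singleton_indep hx)
  refine linearIndepOn_iff.1 hind l ?_ hl
  rw [Finsupp.mem_supported, ← Finsupp.fun_support_eq]
  exact Set.subset_sdiff_singleton hlC hxl

theorem support_incidenceVector (C : Set α) : support (Matroid.incidenceVector C) = C := by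
  simp [Matroid.incidenceVector]

theorem eq_incidenceVector_support (x : α → ZMod 2) :
    x = Matroid.incidenceVector (support x) := by
  ext a
  have : ∀ c : ZMod 2, c ≠ 0 → c = 1 := by decide
  by_cases h : x a = 0
  · simp [Matroid.incidenceVector, h]
  · simp [Matroid.incidenceVector, this _ h]

theorem incidenceVector_symmDiff (C D : Set α) :
    Matroid.incidenceVector (C ∆ D) = Matroid.incidenceVector C + Matroid.incidenceVector D := by
  ext x
  by_cases hC : x ∈ C <;> by_cases hD : x ∈ D <;>
    simp [Matroid.incidenceVector, Set.mem_symmDiff, hC, hD, CharTwo.add_self_eq_zero]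

theorem eq_zero_of_mem_circuitSpace_of_indep_support (hM : M.IsRepresentableOver (ZMod 2))
    {x : α → ZMod 2} (hx : x ∈ M.circuitSpace) (hind : M.Indep (support x)) : x = 0 := by
  obtain ⟨n, A, hA⟩ := hM
  have hle : M.circuitSpace ≤
      (LinearMap.ker (Finsupp.linearCombination (ZMod 2) A.col)).map Finsupp.lcoeFun := by
    refine Submodule.span_le.2 ?_
    rintro _ ⟨C, hC, rfl⟩
    obtain ⟨l, rfl, hl⟩ := exists_linearCombination_eq_zero_of_isCircuit hA hC
    exact ⟨l, hl, eq_incidenceVector_support l⟩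
  obtain ⟨l, hl, rfl⟩ := hle hx
  have hl0 : l = 0 := linearIndepOn_iff.1 ((hA _ hind.subset_ground).1 hind) l
    (by rw [Finsupp.mem_supported, ← Finsupp.fun_support_eq, Finsupp.lcoeFun_apply]) hl
  rw [hl0, map_zero]

theorem incidenceVector_mem_circuitSpace {C : Set α} (hC : M.IsCircuit C) :
    Matroid.incidenceVector C ∈ M.circuitSpace :=
  Submodule.subset_span ⟨C, hC, rfl⟩

theorem isCircuit_eq_or_eq_or_eq_symmDiff (hM : M.IsRepresentableOver (ZMod 2)) {I C D K : Set α}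
    {e f : α} (hI : M.Indep I) (hC : M.IsCircuit C) (hD : M.IsCircuit D) (hK : M.IsCircuit K)
    (hCI : C ⊆ insert e I) (hDI : D ⊆ insert f I) (hKI : K ⊆ insert e (insert f I)) :
    K = C ∨ K = D ∨ K = C ∆ D := by
  by_cases hKe : K ⊆ insert e I
  · exact .inl ((hK.eq_fundCircuit_of_subset hI hKe).trans
      (hC.eq_fundCircuit_of_subset hI hCI).symm)
  by_cases hKf : K ⊆ insert f I
  · exact .inr (.inl ((hK.eq_fundCircuit_of_subset hI hKf).trans
      (hD.eq_fundCircuit_of_subset hI hDI).symm))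
  have hCI' : ¬ C ⊆ I := fun h => hC.not_indep (hI.subset h)
  have hDI' : ¬ D ⊆ I := fun h => hD.not_indep (hI.subset h)
  have hsub : K ∆ (C ∆ D) ⊆ I := by
    intro x hx
    simp only [Set.mem_symmDiff, Set.subset_def, Set.mem_insert_iff] at *
    grind
  have hzero := eq_zero_of_mem_circuitSpace_of_indep_support hM
    (x := Matroid.incidenceVector (K ∆ (C ∆ D)))
    (by
      simp only [incidenceVector_symmDiff]
      exact add_mem (incidenceVector_mem_circuitSpace hK)
        (add_mem (incidenceVector_mem_circuitSpace hC) (incidenceVector_mem_circuitSpace hD)))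
    (by rw [support_incidenceVector]; exact hI.subset hsub)
  rw [← support_eq_empty_iff, support_incidenceVector, ← Set.bot_eq_empty, symmDiff_eq_bot] at hzero
  exact .inr (.inr hzero)

end Representable

namespace OrientedMatroid

open Function

variable {α : Type u} {O : OrientedMatroid α}

/-- The vector over `ℤ` encoding a signed set `X = (X⁺, X⁻)`: its entries are `1` on `X⁺`, `-1` on
`X⁻` and `0` elsewhere. -/
noncomputable def signVector (X : Set α × Set α) : α → ℤ :=
  X.1.indicator 1 - X.2.indicator 1

theorem signVector_swap (X : Set α × Set α) : signVector X.swap = -signVector X := by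
  simp [signVector]

theorem signVector_empty_right (C : Set α) : signVector (C, ∅) = C.indicator 1 := by
  rw [signVector, Set.indicator_empty', sub_zero]

theorem signVector_eq_one_iff {X : Set α × Set α} (hX : Disjoint X.1 X.2) {x : α} :
    signVector X x = 1 ↔ x ∈ X.1 := by
  have : x ∈ X.1 → x ∉ X.2 := fun h => Set.disjoint_left.1 hX h
  by_cases h1 : x ∈ X.1 <;> by_cases h2 : x ∈ X.2 <;> simp_all [signVector]

theorem signVector_eq_neg_one_iff {X : Set α × Set α} (hX : Disjoint X.1 X.2) {x : α} :
    signVector X x = -1 ↔ x ∈ X.2 := by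
  rw [← neg_eq_iff_eq_neg, ← Pi.neg_apply, ← signVector_swap, signVector_eq_one_iff hX.symm,
    Prod.fst_swap]

theorem support_signVector {X : Set α × Set α} (hX : Disjoint X.1 X.2) :
    support (signVector X) = X.1 ∪ X.2 := by
  ext x
  have : x ∈ X.1 → x ∉ X.2 := fun h => Set.disjoint_left.1 hX h
  by_cases h1 : x ∈ X.1 <;> by_cases h2 : x ∈ X.2 <;> simp_all [signVector]

/-- The signed circuits of `O`, encoded as vectors over `ℤ` with entries in `{-1, 0, 1}`. -/
def circuitVectors (O : OrientedMatroid α) : Set (α → ℤ) :=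
  signVector '' O.circuits

section CircuitVectors

variable {u v : α → ℤ}

theorem neg_mem_circuitVectors (hv : v ∈ O.circuitVectors) : -v ∈ O.circuitVectors := by
  obtain ⟨X, hX, rfl⟩ := hv
  exact ⟨X.swap, O.swap_mem X hX, signVector_swap X⟩

theorem circuitVectors_apply (hv : v ∈ O.circuitVectors) (x : α) :
    v x = 0 ∨ v x = 1 ∨ v x = -1 := by
  obtain ⟨X, hX, rfl⟩ := hv
  by_cases h : x ∈ X.1 ∪ X.2
  · rw [signVector_eq_one_iff (O.disjoint X hX), signVector_eq_neg_one_iff (O.disjoint X hX)]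
    exact .inr h
  · rw [← support_signVector (O.disjoint X hX), notMem_support] at h
    exact .inl h

theorem isCircuit_support (hv : v ∈ O.circuitVectors) : O.underlying.IsCircuit (support v) := by
  obtain ⟨X, hX, rfl⟩ := hv
  rw [support_signVector (O.disjoint X hX)]
  exact (O.underlying_isCircuit_iff _).2 ⟨X, hX, rfl⟩

theorem exists_circuitVector_support_eq {C : Set α} (hC : O.underlying.IsCircuit C) {b : α}
    (hb : b ∈ C) : ∃ v ∈ O.circuitVectors, support v = C ∧ v b = 1 := by
  obtain ⟨X, hX, rfl⟩ := (O.underlying_isCircuit_iff C).1 hC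
  have hv : signVector X ∈ O.circuitVectors := ⟨X, hX, rfl⟩
  have hsupp := support_signVector (O.disjoint X hX)
  rw [← hsupp, mem_support] at hb
  obtain h | h | h := circuitVectors_apply hv b
  · exact absurd h hb
  · exact ⟨_, hv, hsupp, h⟩
  · exact ⟨_, neg_mem_circuitVectors hv, by rw [support_neg, hsupp], by simp [h]⟩

theorem eq_or_eq_neg_of_support_subset (hu : u ∈ O.circuitVectors) (hv : v ∈ O.circuitVectors)
    (h : support u ⊆ support v) : u = v ∨ u = -v := by
  obtain ⟨X, hX, rfl⟩ := hu
  obtain ⟨Y, hY, rfl⟩ := hv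
  rw [support_signVector (O.disjoint X hX), support_signVector (O.disjoint Y hY)] at h
  rw [← signVector_swap]
  exact (O.incomparable X hX Y hY h).imp (congrArg signVector) (congrArg signVector)

theorem exists_circuitVector_elimination (hu : u ∈ O.circuitVectors) (hv : v ∈ O.circuitVectors)
    (hne : support u ≠ support v) {b : α} (hub : u b ≠ 0) (huv : u b + v b = 0) :
    ∃ w ∈ O.circuitVectors, w b = 0 ∧ ∀ x, w x = 0 ∨ w x = u x ∨ w x = v x := by
  wlog hub' : u b = 1 generalizing u v
  · have hub1 := circuitVectors_apply hu b
    obtain ⟨w, hw, hwb, hwx⟩ := this hv hu hne.symm (by lia) (by lia) (by lia)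
    exact ⟨w, hw, hwb, fun x => (hwx x).imp_right Or.symm⟩
  have hvb : v b = -1 := by lia
  obtain ⟨X, hX, rfl⟩ := hu
  obtain ⟨Y, hY, rfl⟩ := hv
  have hXY : X ≠ Y.swap := by
    rintro rfl
    exact hne (by rw [signVector_swap, support_neg])
  obtain ⟨Z, hZ, hZ1, hZ2⟩ := O.elimination X hX Y hY hXY b
    ⟨(signVector_eq_one_iff (O.disjoint X hX)).1 hub',
      (signVector_eq_neg_one_iff (O.disjoint Y hY)).1 hvb⟩
  have pos {W} (hW : W ∈ O.circuits) {x} := signVector_eq_one_iff (O.disjoint W hW) (x := x)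
  have neg {W} (hW : W ∈ O.circuits) {x} := signVector_eq_neg_one_iff (O.disjoint W hW) (x := x)
  refine ⟨_, ⟨Z, hZ, rfl⟩, ?_, fun x => ?_⟩
  · rw [← notMem_support, support_signVector (O.disjoint Z hZ)]
    rintro (h | h)
    exacts [(hZ1 h).2 rfl, (hZ2 h).2 rfl]
  · obtain h | h | h := circuitVectors_apply ⟨Z, hZ, rfl⟩ x
    · exact .inl h
    · exact .inr ((hZ1 ((pos hZ).1 h)).1.imp (h.trans <| .symm <| (pos hX).2 ·)
        (h.trans <| .symm <| (pos hY).2 ·))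
    · exact .inr ((hZ2 ((neg hZ).1 h)).1.imp (h.trans <| .symm <| (neg hX).2 ·)
        (h.trans <| .symm <| (neg hY).2 ·))

/-- Two vectors form a binary pair if every signed circuit within the union of their supports has
one of the three supports that occur in a binary matroid: those of `u`, of `v`, or their symmetric
difference. It is for such pairs that signed elimination determines the eliminated circuit. -/
def IsBinaryPair (O : OrientedMatroid α) (u v : α → ℤ) : Prop :=
  ∀ w ∈ O.circuitVectors, support w ⊆ support u ∪ support v →
    support w = support u ∨ support w = support v ∨ support w = support u ∆ support v

theorem IsBinaryPair.neg_right (h : O.IsBinaryPair u v) : O.IsBinaryPair u (-v) := by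
  simpa only [IsBinaryPair, support_neg] using h

theorem IsBinaryPair.exists_support_eq_symmDiff (h : O.IsBinaryPair u v)
    (hu : u ∈ O.circuitVectors) (hv : v ∈ O.circuitVectors) (hne : support u ≠ support v) {b : α}
    (hub : u b ≠ 0) (huv : u b + v b = 0) :
    ∃ w ∈ O.circuitVectors, support w = support u ∆ support v ∧
      ∀ x, u x = 0 ∨ v x = 0 → w x = u x + v x := by
  obtain ⟨w, hw, hwb, hwx⟩ := exists_circuitVector_elimination hu hv hne hub huv
  have hsub : support w ⊆ support u ∪ support v := by
    intro x hx
    have := hwx x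
    simp only [Set.mem_union, mem_support] at hx ⊢
    lia
  have hsupp : support w = support u ∆ support v := by
    obtain h | h | h := h w hw hsub
    · exact absurd (h ▸ mem_support.2 hub : b ∈ support w) (notMem_support.2 hwb)
    · exact absurd (h ▸ mem_support.2 (by lia) : b ∈ support w) (notMem_support.2 hwb)
    · exact h
  refine ⟨w, hw, hsupp, fun x hx => ?_⟩
  have hmem : w x ≠ 0 ↔ u x ≠ 0 ∧ v x = 0 ∨ v x ≠ 0 ∧ u x = 0 := by
    simpa [Set.mem_symmDiff] using Set.ext_iff.1 hsupp x
  have := hwx x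
  lia

theorem IsBinaryPair.add_mem_circuitVectors (h : O.IsBinaryPair u v) (hu : u ∈ O.circuitVectors)
    (hv : v ∈ O.circuitVectors) (hne : support u ≠ support v) {b : α} (hub : u b ≠ 0)
    (huv : u b + v b = 0) : u + v ∈ O.circuitVectors := by
  obtain ⟨w, hw, hwsupp, hwx⟩ := h.exists_support_eq_symmDiff hu hv hne hub huv
  suffices w = u + v from this ▸ hw
  ext x
  by_cases hx : u x = 0 ∨ v x = 0
  · exact hwx x hx
  have hwx0 : w x = 0 := by
    rw [← notMem_support, hwsupp, Set.mem_symmDiff, mem_support, mem_support]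
    lia
  -- Otherwise `u` and `-v` can be eliminated at `x` too, which gives a signed circuit with the
  -- support of `w` that agrees with `w` on `support u \ support v` but not on the rest.
  by_contra hne'
  have hux := circuitVectors_apply hu x
  have hvx := circuitVectors_apply hv x
  simp only [Pi.add_apply] at hne'
  obtain ⟨w', hw', hwsupp', hwx'⟩ := h.neg_right.exists_support_eq_symmDiff hu
    (neg_mem_circuitVectors hv) (by rwa [support_neg]) (b := x) (by lia)
    (by simp only [Pi.neg_apply]; lia)
  simp only [support_neg, Pi.neg_apply, neg_eq_zero] at hwsupp' hwx'
  obtain ⟨y, hyu, hyv⟩ := Set.not_subset.1 fun hsub =>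
    hne ((isCircuit_support hu).eq_of_subset_isCircuit (isCircuit_support hv) hsub)
  obtain ⟨z, hzv, hzu⟩ := Set.not_subset.1 fun hsub =>
    hne ((isCircuit_support hv).eq_of_subset_isCircuit (isCircuit_support hu) hsub).symm
  simp only [mem_support, not_not] at hyu hyv hzu hzv
  have := hwx y (.inr hyv)
  have := hwx' y (.inr hyv)
  have := hwx z (.inl hzu)
  have := hwx' z (.inl hzu)
  obtain rfl | rfl := eq_or_eq_neg_of_support_subset hw hw' (hwsupp.trans hwsupp'.symm).subset
  · lia
  · simp only [Pi.neg_apply] at *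
    lia

theorem IsBinaryPair.mem_span_pair (h : O.IsBinaryPair u v) (hu : u ∈ O.circuitVectors)
    (hv : v ∈ O.circuitVectors) (huv : (support u ∩ support v).Nonempty) {w : α → ℤ}
    (hw : w ∈ O.circuitVectors) (hwsupp : support w = support u ∆ support v) :
    w ∈ Submodule.span ℤ {u, v} := by
  obtain ⟨b, hub, hvb⟩ := huv
  rw [mem_support] at hub hvb
  have hne : support u ≠ support v := by
    intro heq
    exact (isCircuit_support hw).nonempty.ne_empty (by rw [hwsupp, heq, symmDiff_self]; rfl)
  wlog hb : u b + v b = 0 generalizing v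
  · have hub' := circuitVectors_apply hu b
    have hvb' := circuitVectors_apply hv b
    have := this h.neg_right (neg_mem_circuitVectors hv) (by rwa [support_neg])
      (by simpa using hvb) (by rwa [support_neg]) (by simp only [Pi.neg_apply]; lia)
    refine Submodule.span_le.2 ?_ this
    simp [Set.insert_subset_iff, Submodule.mem_span_of_mem]
  have hadd := h.add_mem_circuitVectors hu hv hne hub hb
  have hmem : u + v ∈ Submodule.span ℤ {u, v} :=
    add_mem (Submodule.mem_span_of_mem (by simp)) (Submodule.mem_span_of_mem (by simp))
  have hsub : support w ⊆ support (u + v) := by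
    intro x hx
    rw [hwsupp, Set.mem_symmDiff] at hx
    simp only [mem_support, Pi.add_apply] at hx ⊢
    lia
  obtain rfl | rfl := eq_or_eq_neg_of_support_subset hw hadd hsub
  exacts [hmem, neg_mem hmem]

end CircuitVectors

/-- The lattice of integer flows, generated by the signed circuits. -/
def flowLattice (O : OrientedMatroid α) : Submodule ℤ (α → ℤ) :=
  Submodule.span ℤ O.circuitVectors

/-- The sublattice of the flow lattice generated by the signed circuits that have at most one
element outside `B`; for a base `B` these are the fundamental circuits of `B`. -/
def fundamentalFlows (O : OrientedMatroid α) (B : Set α) : Submodule ℤ (α → ℤ) :=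
  Submodule.span ℤ {v ∈ O.circuitVectors | ∃ e, support v ⊆ insert e B}

section Fundamental

variable {v w : α → ℤ} {B B' : Set α} {e f : α}

theorem mem_flowLattice_of_mem_circuitVectors (hv : v ∈ O.circuitVectors) : v ∈ O.flowLattice :=
  Submodule.subset_span hv

theorem mem_fundamentalFlows_of_mem_circuitVectors (hv : v ∈ O.circuitVectors)
    (hvB : support v ⊆ insert e B) : v ∈ O.fundamentalFlows B :=
  Submodule.subset_span ⟨hv, e, hvB⟩

theorem mem_fundamentalFlows_of_support_subset_insert_insert
    (hbin : O.underlying.IsRepresentableOver (ZMod 2)) (hB : O.underlying.IsBase B)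
    (hv : v ∈ O.circuitVectors) (hvB : support v ⊆ insert e (insert f B)) :
    v ∈ O.fundamentalFlows B := by
  by_cases hve : support v ⊆ insert e B
  · exact mem_fundamentalFlows_of_mem_circuitVectors hv hve
  by_cases hvf : support v ⊆ insert f B
  · exact mem_fundamentalFlows_of_mem_circuitVectors hv hvf
  have hvC := isCircuit_support hv
  obtain ⟨hev, heB, hfv, hfB⟩ : e ∈ support v ∧ e ∉ B ∧ f ∈ support v ∧ f ∉ B := by
    simp only [Set.subset_def, Set.mem_insert_iff] at *
    grind
  have hC := hB.fundCircuit_isCircuit (hvC.subset_ground hev) heB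
  have hD := hB.fundCircuit_isCircuit (hvC.subset_ground hfv) hfB
  have hCB := O.underlying.fundCircuit_subset_insert e B
  have hDB := O.underlying.fundCircuit_subset_insert f B
  have htri {K : Set α} (hK : O.underlying.IsCircuit K) (hKB : K ⊆ insert e (insert f B)) :=
    isCircuit_eq_or_eq_or_eq_symmDiff hbin hB.indep hC hD hK hCB hDB hKB
  obtain ⟨x, hx, hxC, -⟩ := exists_circuitVector_support_eq hC (O.underlying.mem_fundCircuit e B)
  obtain ⟨y, hy, hyD, -⟩ := exists_circuitVector_support_eq hD (O.underlying.mem_fundCircuit f B)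
  rw [← hxC] at htri hCB
  rw [← hyD] at htri hDB
  have hxy : O.IsBinaryPair x y := fun w hw hwxy => htri (isCircuit_support hw)
    (hwxy.trans (by grind))
  have hvxy : support v = support x ∆ support y := by
    obtain h | h | h := htri hvC hvB
    exacts [absurd (h ▸ hCB) hve, absurd (h ▸ hDB) hvf, h]
  have hmeet : (support x ∩ support y).Nonempty := by
    rw [← Set.not_disjoint_iff_nonempty_inter]
    intro hdisj
    have hxv : support x ⊆ support v := by
      rw [hvxy, hdisj.symmDiff_eq_sup]
      exact Set.subset_union_left
    exact hve (((isCircuit_support hx).eq_of_subset_isCircuit hvC hxv) ▸ hCB)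
  refine Submodule.span_le.2 ?_ (hxy.mem_span_pair hx hy hmeet hv hvxy)
  rintro _ (rfl | rfl)
  exacts [mem_fundamentalFlows_of_mem_circuitVectors hx hCB,
    mem_fundamentalFlows_of_mem_circuitVectors hy hDB]

theorem fundamentalFlows_le_of_isBase (hbin : O.underlying.IsRepresentableOver (ZMod 2))
    (hB : O.underlying.IsBase B) (hB' : O.underlying.IsBase B') :
    O.fundamentalFlows B' ≤ O.fundamentalFlows B := by
  induction hn : (B' \ B).ncard generalizing B' with
  | zero =>
    have hfin : (B' \ B).Finite := O.ground_finite.subset (Set.sdiff_subset.trans hB'.subset_ground)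
    have hsub : B' ⊆ B := Set.sdiff_eq_empty.1 ((Set.ncard_eq_zero hfin).1 hn)
    rw [hB'.eq_of_subset_isBase hB hsub]
  | succ n ih =>
    obtain ⟨e, he⟩ := Set.nonempty_of_ncard_ne_zero (hn.trans_ne n.succ_ne_zero)
    obtain ⟨f, hf, hB''⟩ := hB'.exchange hB he
    have hcard : (insert f (B' \ {e}) \ B).ncard = n := by
      rw [Set.insert_sdiff_of_mem _ hf.1, sdiff_right_comm,
        Set.ncard_sdiff_singleton_of_mem he, hn, Nat.add_sub_cancel]
    refine le_trans (Submodule.span_le.2 ?_) (ih hB'' hcard)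
    rintro v ⟨hv, g, hvg⟩
    refine mem_fundamentalFlows_of_support_subset_insert_insert hbin hB'' hv
      (e := g) (f := e) (hvg.trans (Set.insert_subset_insert ?_))
    intro x hx
    by_cases hxe : x = e <;> simp [hx, hxe]

theorem flowLattice_le_fundamentalFlows (hbin : O.underlying.IsRepresentableOver (ZMod 2))
    (hB : O.underlying.IsBase B) : O.flowLattice ≤ O.fundamentalFlows B := by
  refine Submodule.span_le.2 fun v hv => ?_
  have hvC := isCircuit_support hv
  obtain ⟨e, he⟩ := hvC.nonempty
  obtain ⟨B', hB', hvB'⟩ := (hvC.sdiff_singleton_indep he).exists_isBase_superset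
  exact fundamentalFlows_le_of_isBase hbin hB hB'
    (mem_fundamentalFlows_of_mem_circuitVectors hv (Set.sdiff_singleton_subset_iff.1 hvB'))

theorem eq_sum_smul_of_mem_fundamentalFlows (hB : O.underlying.IsBase B) {s : Finset α}
    (hs : (s : Set α) = O.E \ B) {x : α → α → ℤ} (hx : ∀ e ∈ s, x e ∈ O.circuitVectors)
    (hxB : ∀ e ∈ s, support (x e) ⊆ insert e B) (hxe : ∀ e ∈ s, x e e = 1)
    (hw : w ∈ O.fundamentalFlows B) : w = ∑ e ∈ s, w e • x e := by
  let coordinates : (α → ℤ) →ₗ[ℤ] α → ℤ := ∑ e ∈ s, (LinearMap.proj e).smulRight (x e)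
  suffices Set.EqOn (LinearMap.id (R := ℤ)) coordinates (O.fundamentalFlows B) by
    simpa [coordinates] using this hw
  refine LinearMap.eqOn_span ?_
  rintro v ⟨hv, e, hvB⟩
  have hvC := isCircuit_support hv
  have hev : e ∈ support v := by
    by_contra hev
    exact hvC.not_indep (hB.indep.subset ((Set.subset_insert_iff_of_notMem hev).1 hvB))
  have heB : e ∉ B := fun heB =>
    hvC.not_indep (hB.indep.subset (by rwa [Set.insert_eq_of_mem heB] at hvB))
  have hes : e ∈ s := by
    rw [← Finset.mem_coe, hs]
    exact ⟨hvC.subset_ground hev, heB⟩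
  have hsum : coordinates v = v e • x e := by
    simp only [coordinates, LinearMap.sum_apply, LinearMap.smulRight_apply, LinearMap.proj_apply]
    refine Finset.sum_eq_single_of_mem e hes fun g hg hge => ?_
    have hgB : g ∈ O.E \ B := hs ▸ Finset.mem_coe.2 hg
    rw [notMem_support.1 fun hgv => hgB.2 ((hvB hgv).resolve_left hge), zero_smul]
  have hsupp : support (x e) = support v :=
    ((isCircuit_support (hx e hes)).eq_fundCircuit_of_subset hB.indep (hxB e hes)).trans
      (hvC.eq_fundCircuit_of_subset hB.indep hvB).symm
  rw [LinearMap.id_apply, hsum]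
  obtain h | h := eq_or_eq_neg_of_support_subset hv (hx e hes) hsupp.superset
  all_goals simp [h, hxe e hes]

theorem eq_zero_of_mem_flowLattice_of_indep_support
    (hbin : O.underlying.IsRepresentableOver (ZMod 2)) (hw : w ∈ O.flowLattice)
    (hind : O.underlying.Indep (support w)) : w = 0 := by
  obtain ⟨B, hB, hwB⟩ := hind.exists_isBase_superset
  obtain ⟨s, hs⟩ := (O.ground_finite.subset (Set.sdiff_subset (t := B))).exists_finset_coe
  have hfund (e : α) (he : e ∈ s) :
      ∃ x ∈ O.circuitVectors, support x = O.underlying.fundCircuit e B ∧ x e = 1 := by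
    have heB : e ∈ O.E \ B := hs ▸ Finset.mem_coe.2 he
    exact exists_circuitVector_support_eq (hB.fundCircuit_isCircuit heB.1 heB.2)
      (O.underlying.mem_fundCircuit e B)
  choose! x hx hxsupp hxe using hfund
  rw [eq_sum_smul_of_mem_fundamentalFlows hB hs hx
    (fun e he => hxsupp e he ▸ O.underlying.fundCircuit_subset_insert e B) hxe
    (flowLattice_le_fundamentalFlows hbin hB hw)]
  refine Finset.sum_eq_zero fun e he => ?_
  have heB : e ∈ O.E \ B := hs ▸ Finset.mem_coe.2 he
  rw [notMem_support.1 fun hew => heB.2 (hwB hew), zero_smul]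

theorem support_subset_ground_of_mem_flowLattice (hw : w ∈ O.flowLattice) : support w ⊆ O.E := by
  intro x hx
  by_contra hxE
  have hle : O.flowLattice ≤ LinearMap.ker (LinearMap.proj x : (α → ℤ) →ₗ[ℤ] ℤ) :=
    Submodule.span_le.2 fun v hv =>
      notMem_support.1 fun hxv => hxE ((isCircuit_support hv).subset_ground hxv)
  exact hx (hle hw)

theorem finite_support_of_mem_flowLattice (hw : w ∈ O.flowLattice) : (support w).Finite :=
  O.ground_finite.subset (support_subset_ground_of_mem_flowLattice hw)

end Fundamental

/-- The directed circuits contained in `S`. -/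
def directedCircuitsIn (O : OrientedMatroid α) (S : Set α) : Set (Set α) :=
  {C | O.IsDirectedCircuit C ∧ C ⊆ S}

theorem directedCircuitsIn_mono {S T : Set α} (h : S ⊆ T) :
    O.directedCircuitsIn S ⊆ O.directedCircuitsIn T :=
  fun _ hC => ⟨hC.1, hC.2.trans h⟩

theorem IsDirectedCircuit.indicator_mem_circuitVectors {C : Set α} (hC : O.IsDirectedCircuit C) :
    C.indicator 1 ∈ O.circuitVectors :=
  ⟨_, hC, signVector_empty_right C⟩

theorem IsDirectedCircuit.indicator_mem_flowLattice {C : Set α} (hC : O.IsDirectedCircuit C) :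
    C.indicator 1 ∈ O.flowLattice :=
  mem_flowLattice_of_mem_circuitVectors hC.indicator_mem_circuitVectors

theorem IsDirectedCircuit.isCircuit {C : Set α} (hC : O.IsDirectedCircuit C) :
    O.underlying.IsCircuit C :=
  (O.underlying_isCircuit_iff C).2 ⟨_, hC, Set.union_empty C⟩

theorem isDirectedCircuit_support_of_nonneg {v : α → ℤ} (hv : v ∈ O.circuitVectors)
    (h0 : 0 ≤ v) : O.IsDirectedCircuit (support v) := by
  obtain ⟨X, hX, rfl⟩ := hv
  have hX2 : X.2 = ∅ := Set.eq_empty_of_forall_notMem fun x hx => by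
    have := (signVector_eq_neg_one_iff (O.disjoint X hX)).2 hx
    have := h0 x
    simp only [Pi.zero_apply] at this
    lia
  rwa [support_signVector (O.disjoint X hX), hX2, Set.union_empty, IsDirectedCircuit, ← hX2]

theorem exists_sub_smul_nonneg {w v : α → ℤ} (hfin : (support w).Finite) (hw : 0 ≤ w)
    (hv : ∀ x, v x ≤ 1) (hvw : support v ⊆ support w) {b : α} (hb : v b = 1) :
    ∃ a, v a = 1 ∧ 0 ≤ w - w a • v := by
  have hfin' : {x | v x = 1}.Finite := hfin.subset fun x (hx : v x = 1) => hvw (by simp [hx])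
  obtain ⟨a, ha, hmin⟩ := Set.exists_min_image _ w hfin' ⟨b, hb⟩
  refine ⟨a, ha, fun x => ?_⟩
  have hwa : 0 ≤ w a := hw a
  have hwx : 0 ≤ w x := hw x
  simp only [Pi.zero_apply, Pi.sub_apply, Pi.smul_apply, smul_eq_mul]
  obtain h | h := (hv x).lt_or_eq
  · nlinarith
  · simpa [h] using hmin x h

theorem support_sub_smul_ssubset {w v : α → ℤ} (hvw : support v ⊆ support w) {a : α}
    (ha : v a = 1) : support (w - w a • v) ⊂ support w := by
  refine Set.ssubset_iff_of_subset ?_ |>.2 ⟨a, hvw (by simp [ha]), by simp [ha]⟩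
  intro x hx hwx
  exact hx (by simp [hwx, notMem_support.1 fun hxv => hvw hxv hwx])

section NonnegativeFlows

variable {w : α → ℤ}

theorem exists_isDirectedCircuit_subset_support (hbin : O.underlying.IsRepresentableOver (ZMod 2))
    (hw : w ∈ O.flowLattice) (hw0 : 0 ≤ w) (hne : w ≠ 0) :
    ∃ C, O.IsDirectedCircuit C ∧ C ⊆ support w := by
  induction hn : (support w).ncard using Nat.strong_induction_on generalizing w with
  | _ n ih =>
    subst hn
    have hfin := finite_support_of_mem_flowLattice hw
    have hdep : O.underlying.Dep (support w) :=
      ⟨fun h => hne (eq_zero_of_mem_flowLattice_of_indep_support hbin hw h),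
        support_subset_ground_of_mem_flowLattice hw⟩
    obtain ⟨C, hCw, hC⟩ := hdep.exists_isCircuit_subset
    obtain ⟨b, hb⟩ := hC.nonempty
    obtain ⟨v, hv, rfl, hvb⟩ := exists_circuitVector_support_eq hC hb
    by_cases hv0 : 0 ≤ v
    · exact ⟨_, isDirectedCircuit_support_of_nonneg hv hv0, hCw⟩
    have hv1 (x : α) : v x ≤ 1 := by have := circuitVectors_apply hv x; lia
    obtain ⟨a, ha, hnonneg⟩ := exists_sub_smul_nonneg hfin hw0 hv1 hCw hvb
    have hlt := support_sub_smul_ssubset hCw ha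
    have hflow : w - w a • v ∈ O.flowLattice :=
      sub_mem hw (Submodule.smul_mem _ _ (mem_flowLattice_of_mem_circuitVectors hv))
    have hne' : w - w a • v ≠ 0 := by
      refine fun h => hv0 fun x => ?_
      have hwa : 0 < w a := (hw0 a).lt_of_ne' (hCw (by simp [ha]))
      exact nonneg_of_mul_nonneg_right ((hw0 x).trans_eq (congrFun (sub_eq_zero.1 h) x)) hwa
    obtain ⟨D, hD, hDsub⟩ := ih _ (Set.ncard_lt_ncard hlt hfin) hflow hnonneg hne' rfl
    exact ⟨D, hD, hDsub.trans hlt.subset⟩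

theorem mem_closure_indicator_of_nonneg (hbin : O.underlying.IsRepresentableOver (ZMod 2))
    (hw : w ∈ O.flowLattice) (hw0 : 0 ≤ w) :
    w ∈ AddSubmonoid.closure
      ((fun C : Set α => C.indicator 1) '' O.directedCircuitsIn (support w)) := by
  induction hn : (support w).ncard using Nat.strong_induction_on generalizing w with
  | _ n ih =>
    subst hn
    obtain rfl | hne := eq_or_ne w 0
    · exact zero_mem _
    have hfin := finite_support_of_mem_flowLattice hw
    obtain ⟨C, hC, hCw⟩ := exists_isDirectedCircuit_subset_support hbin hw hw0 hne
    have hCmem : C ∈ O.directedCircuitsIn (support w) := ⟨hC, hCw⟩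
    obtain ⟨b, hb⟩ := hC.isCircuit.nonempty
    have hCw' : support (C.indicator (1 : α → ℤ)) ⊆ support w := by simpa using hCw
    have hle (x : α) : C.indicator (1 : α → ℤ) x ≤ 1 := Set.indicator_apply_le' (by simp) (by simp)
    obtain ⟨a, ha, hnonneg⟩ := exists_sub_smul_nonneg hfin hw0 hle hCw'
      (Set.indicator_of_mem hb 1)
    have hlt := support_sub_smul_ssubset hCw' ha
    have hrest := ih _ (Set.ncard_lt_ncard hlt hfin)
      (sub_mem hw (Submodule.smul_mem _ _ hC.indicator_mem_flowLattice)) hnonneg rfl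
    have hmono := AddSubmonoid.closure_mono
      (Set.image_mono (f := fun C : Set α => C.indicator (1 : α → ℤ))
        (directedCircuitsIn_mono (O := O) hlt.subset))
    obtain ⟨k, hk⟩ := Int.eq_ofNat_of_zero_le (hw0 a)
    rw [hk, natCast_zsmul] at hrest hmono
    have hsum := add_mem (hmono hrest)
      (nsmul_mem (AddSubmonoid.subset_closure (Set.mem_image_of_mem _ hCmem)) k)
    rwa [sub_add_cancel] at hsum

theorem exists_isDirectedCircuit_mem_subset_support
    (hbin : O.underlying.IsRepresentableOver (ZMod 2)) (hw : w ∈ O.flowLattice) (hw0 : 0 ≤ w)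
    {a : α} (ha : w a ≠ 0) : ∃ C, O.IsDirectedCircuit C ∧ C ⊆ support w ∧ a ∈ C := by
  by_contra! hcon
  refine ha ((AddSubmonoid.closure_le (S := AddMonoidHom.mker (Pi.evalAddMonoidHom _ a))).2 ?_
    (mem_closure_indicator_of_nonneg hbin hw hw0))
  rintro _ ⟨C, ⟨hC, hCw⟩, rfl⟩
  exact Set.indicator_of_notMem (hcon C hC hCw) 1

end NonnegativeFlows

theorem isDirectedCircuit_delete_iff {A C : Set α} :
    (O.delete A).IsDirectedCircuit C ↔ O.IsDirectedCircuit C ∧ Disjoint C A := by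
  rw [IsDirectedCircuit, delete, Set.mem_ofPred_eq, Set.union_empty, IsDirectedCircuit]

theorem delete_empty (O : OrientedMatroid α) : O.delete ∅ = O := by
  simp [delete]

section TotallyCyclicDeletion

variable {A : Set α} {w : α → ℤ} {D : α → Set α}

theorem exists_positive_flow (hcyc : (O.delete A).IsTotallyCyclic) :
    ∃ p ∈ O.flowLattice, 0 ≤ p ∧ (∀ x ∈ A, p x = 0) ∧ ∀ x ∈ O.E \ A, 0 < p x := by
  obtain ⟨s, hs⟩ := (O.ground_finite.subset (Set.sdiff_subset (t := A))).exists_finset_coe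
  have hcyc' (e : α) (he : e ∈ s) : ∃ C, (O.IsDirectedCircuit C ∧ Disjoint C A) ∧ e ∈ C := by
    simp only [← isDirectedCircuit_delete_iff]
    exact hcyc e (hs.subset he)
  choose! C hC heC using hcyc'
  have h0 (e x : α) : 0 ≤ (C e).indicator (1 : α → ℤ) x := Set.indicator_nonneg (by simp) x
  refine ⟨∑ e ∈ s, (C e).indicator 1, sum_mem fun e he => (hC e he).1.indicator_mem_flowLattice,
    Finset.sum_nonneg fun e _ => h0 e, fun x hx => ?_, fun x hx => ?_⟩
  · rw [Finset.sum_apply]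
    exact Finset.sum_eq_zero fun e he =>
      Set.indicator_of_notMem (Set.disjoint_right.1 (hC e he).2 hx) 1
  · rw [Finset.sum_apply]
    have hxs : x ∈ s := Finset.mem_coe.1 (hs.superset hx)
    exact Finset.sum_pos' (fun e _ => h0 e x) ⟨x, hxs, by simp [heC x hxs]⟩

theorem exists_add_nsmul_nonneg {p : α → ℤ} (hfin : (support w).Finite) (hp : 0 ≤ p)
    (hpw : ∀ x, w x < 0 → 0 < p x) : ∃ N : ℕ, 0 ≤ w + N • p := by
  refine ⟨∑ x ∈ hfin.toFinset, (w x).natAbs, fun x => ?_⟩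
  rw [Pi.zero_apply, Pi.add_apply, Pi.smul_apply, nsmul_eq_mul]
  obtain hx | hx := le_or_gt 0 (w x)
  · exact add_nonneg hx (mul_nonneg (Nat.cast_nonneg _) (hp x))
  have hle : (w x).natAbs ≤ ∑ x ∈ hfin.toFinset, (w x).natAbs :=
    Finset.single_le_sum (f := fun x => (w x).natAbs) (fun _ _ => Nat.zero_le _)
      (hfin.mem_toFinset.2 hx.ne)
  have := hpw x hx
  generalize ∑ x ∈ hfin.toFinset, (w x).natAbs = N at *
  have : -w x ≤ N := by lia
  nlinarith

theorem exists_flow_add_nonneg (hcyc : (O.delete A).IsTotallyCyclic) (hw : w ∈ O.flowLattice)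
    (hwA : ∀ x ∈ A, 0 ≤ w x) :
    ∃ p ∈ O.flowLattice, 0 ≤ p ∧ (∀ x ∈ A, p x = 0) ∧ 0 ≤ w + p := by
  obtain ⟨p, hp, hp0, hpA, hppos⟩ := exists_positive_flow hcyc
  obtain ⟨N, hN⟩ := exists_add_nsmul_nonneg (finite_support_of_mem_flowLattice hw) hp0
    fun x hx => hppos x ⟨support_subset_ground_of_mem_flowLattice hw hx.ne,
      fun hxA => (hwA x hxA).not_gt hx⟩
  exact ⟨N • p, nsmul_mem hp N, nsmul_nonneg hp0 N, fun x hx => by simp [hpA x hx], hN⟩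

theorem exists_isDirectedCircuit_inter_eq_singleton
    (hbin : O.underlying.IsRepresentableOver (ZMod 2)) (hA : O.underlying.Coindep A)
    (hcyc : (O.delete A).IsTotallyCyclic) {a : α} (ha : a ∈ A) :
    ∃ C, O.IsDirectedCircuit C ∧ C ∩ A = {a} := by
  obtain ⟨B, hB, hBA⟩ := hA.exists_isBase_subset_compl
  obtain ⟨v, hv, hvsupp, hva⟩ := exists_circuitVector_support_eq
    (hB.fundCircuit_isCircuit (hA.subset_ground ha) fun haB => (hBA haB).2 ha)
    (O.underlying.mem_fundCircuit a B)
  have hvA (x : α) (hx : x ∈ A) (hxa : x ≠ a) : v x = 0 := notMem_support.1 fun hxv =>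
    (hBA ((O.underlying.fundCircuit_subset_insert a B (hvsupp ▸ hxv)).resolve_left hxa)).2 hx
  obtain ⟨p, hp, -, hpA, hnonneg⟩ := exists_flow_add_nonneg hcyc
    (mem_flowLattice_of_mem_circuitVectors hv) (fun x hx => by
      by_cases hxa : x = a
      · simp [hxa, hva]
      · exact (hvA x hx hxa).ge)
  obtain ⟨C, hC, hCsub, haC⟩ := exists_isDirectedCircuit_mem_subset_support hbin
    (add_mem (mem_flowLattice_of_mem_circuitVectors hv) hp) hnonneg (a := a)
    (by simp [hva, hpA a ha])
  refine ⟨C, hC, Set.eq_singleton_iff_unique_mem.2 ⟨⟨haC, ha⟩, fun x hx => ?_⟩⟩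
  by_contra hxa
  exact hCsub hx.1 (by simp [hvA x hx.2 hxa, hpA x hx.2])

theorem mem_span_indicator_of_nonneg (hbin : O.underlying.IsRepresentableOver (ZMod 2))
    (hw : w ∈ O.flowLattice) (hw0 : 0 ≤ w) (hwA : ∀ x ∈ A, w x = 0) :
    w ∈ Submodule.span ℤ ((fun C : Set α => C.indicator (1 : α → ℤ)) ''
      O.directedCircuitsIn Aᶜ) := by
  have hsub : support w ⊆ Aᶜ := fun x hx hxA => hx (hwA x hxA)
  refine (AddSubmonoid.closure_le (S := (Submodule.span ℤ _).toAddSubmonoid)).2 ?_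
    (mem_closure_indicator_of_nonneg hbin hw hw0)
  exact (Set.image_mono (directedCircuitsIn_mono hsub)).trans Submodule.subset_span

theorem mem_span_indicator_of_eq_zero (hbin : O.underlying.IsRepresentableOver (ZMod 2))
    (hcyc : (O.delete A).IsTotallyCyclic) (hw : w ∈ O.flowLattice) (hwA : ∀ x ∈ A, w x = 0) :
    w ∈ Submodule.span ℤ ((fun C : Set α => C.indicator (1 : α → ℤ)) ''
      O.directedCircuitsIn Aᶜ) := by
  obtain ⟨p, hp, hp0, hpA, hnonneg⟩ := exists_flow_add_nonneg hcyc hw fun x hx => (hwA x hx).ge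
  rw [← add_sub_cancel_right w p]
  exact sub_mem
    (mem_span_indicator_of_nonneg hbin (add_mem hw hp) hnonneg fun x hx => by
      simp [hwA x hx, hpA x hx])
    (mem_span_indicator_of_nonneg hbin hp hp0 hpA)

theorem flowLattice_le_span_indicator (hbin : O.underlying.IsRepresentableOver (ZMod 2))
    (hAE : A ⊆ O.E) (hcyc : (O.delete A).IsTotallyCyclic)
    (hD : ∀ a ∈ A, O.IsDirectedCircuit (D a)) (hDA : ∀ a ∈ A, D a ∩ A = {a}) :
    O.flowLattice ≤ Submodule.span ℤ ((fun C : Set α => C.indicator (1 : α → ℤ)) ''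
      (O.directedCircuitsIn Aᶜ ∪ D '' A)) := by
  intro w hw
  obtain ⟨s, rfl⟩ := (O.ground_finite.subset hAE).exists_finset_coe
  have hsum : ∑ a ∈ s, w a • (D a).indicator (1 : α → ℤ) ∈ O.flowLattice :=
    sum_mem fun a ha => Submodule.smul_mem _ _ (hD a ha).indicator_mem_flowLattice
  have hvanish : ∀ x ∈ (s : Set α), (w - ∑ a ∈ s, w a • (D a).indicator (1 : α → ℤ)) x = 0 := by
    intro x hx
    have hxD (a : α) (ha : a ∈ s) : x ∈ D a ↔ x = a := by
      simpa [Finset.mem_coe.1 hx] using Set.ext_iff.1 (hDA a ha) x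
    rw [Pi.sub_apply, Finset.sum_apply, Finset.sum_eq_single_of_mem x hx fun a ha hax => by
      simp [hxD a ha, hax.symm]]
    simp [hxD x hx]
  have hrest := mem_span_indicator_of_eq_zero hbin hcyc (sub_mem hw hsum) hvanish
  rw [← sub_add_cancel w (∑ a ∈ s, w a • (D a).indicator 1)]
  refine add_mem (Submodule.span_mono (Set.image_mono Set.subset_union_left) hrest)
    (sum_mem fun a ha => Submodule.smul_mem _ _ (Submodule.subset_span ?_))
  exact Set.mem_image_of_mem _ (.inr ⟨a, ha, rfl⟩)

end TotallyCyclicDeletion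

theorem circuitSpace_le_span_incidenceVector {G : Set (Set α)}
    (hG : O.flowLattice ≤
      Submodule.span ℤ ((fun C : Set α => C.indicator (1 : α → ℤ)) '' G)) :
    O.underlying.circuitSpace ≤ Submodule.span (ZMod 2) (Matroid.incidenceVector '' G) := by
  let mod2 : (α → ℤ) →ₗ[ℤ] α → ZMod 2 := ((Int.castAddHom (ZMod 2)).compLeft α).toIntLinearMap
  have hmod2 (w : α → ℤ) (x : α) : mod2 w x = w x := rfl
  have hle : O.flowLattice ≤
      ((Submodule.span (ZMod 2) (Matroid.incidenceVector '' G)).restrictScalars ℤ).comap mod2 := by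
    refine hG.trans (Submodule.span_le.2 ?_)
    rintro _ ⟨C, hC, rfl⟩
    have hCmod2 : mod2 (C.indicator 1) = Matroid.incidenceVector C := by
      ext x
      by_cases hx : x ∈ C <;> simp [hmod2, Matroid.incidenceVector, hx]
    simpa only [SetLike.mem_coe, Submodule.mem_comap, Submodule.restrictScalars_mem, hCmod2]
      using Submodule.subset_span (Set.mem_image_of_mem _ hC)
  refine Submodule.span_le.2 ?_
  rintro _ ⟨C, hC, rfl⟩
  obtain ⟨b, hb⟩ := hC.nonempty
  obtain ⟨v, hv, rfl, -⟩ := exists_circuitVector_support_eq hC hb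
  have hvmod2 : mod2 v = Matroid.incidenceVector (support v) := by
    ext x
    obtain h | h | h := circuitVectors_apply hv x <;>
      simp [hmod2, Matroid.incidenceVector, h, ZMod.neg_eq_self_mod_two]
  exact hvmod2 ▸ hle (mem_flowLattice_of_mem_circuitVectors hv)

theorem linearIndepOn_incidenceVector_image {A : Set α} {D : α → Set α}
    (hDA : ∀ a ∈ A, D a ∩ A = {a}) :
    LinearIndepOn (ZMod 2) Matroid.incidenceVector (D '' A) := by
  refine LinearIndepOn.image_of_comp D Matroid.incidenceVector ?_
  have hmem (a b : A) : (b : α) ∈ D a ↔ a = b := by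
    simpa [eq_comm, Subtype.ext_iff] using Set.ext_iff.1 (hDA a a.2) b
  refine LinearIndependent.of_pairwise_dual_eq_zero_one _
    (fun a : A => (LinearMap.proj (a : α) : (α → ZMod 2) →ₗ[ZMod 2] ZMod 2)) ?_ ?_
  · intro a b hab
    simp [Matroid.incidenceVector, hmem, hab.symm]
  · intro a
    simp [Matroid.incidenceVector, hmem]

theorem exists_isDirectedCircuitBasis_of_coindep
    (hbin : O.underlying.IsRepresentableOver (ZMod 2)) {A : Set α} (hA : O.underlying.Coindep A)
    (hcyc : (O.delete A).IsTotallyCyclic) :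
    ∃ B, O.IsDirectedCircuitBasis B ∧ ∀ a ∈ A, ∃! C, C ∈ B ∧ a ∈ C := by
  choose! D hD hDA using fun a (ha : a ∈ A) =>
    exists_isDirectedCircuit_inter_eq_singleton hbin hA hcyc ha
  obtain ⟨B, hBsub, hDB, hspan, hind⟩ := exists_linearIndepOn_extension
    (linearIndepOn_incidenceVector_image hDA)
    (Set.subset_union_right (s := O.directedCircuitsIn Aᶜ))
  have hB : ∀ C ∈ B, O.IsDirectedCircuit C := by
    intro C hC
    obtain hC | ⟨a, ha, rfl⟩ := hBsub hC
    exacts [hC.1, hD a ha]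
  refine ⟨B, ⟨⟨fun C hC => (hB C hC).isCircuit, hind, le_antisymm ?_ ?_⟩, hB⟩, fun a ha => ?_⟩
  · exact Submodule.span_mono (Set.image_mono fun C hC => (hB C hC).isCircuit)
  · exact (circuitSpace_le_span_incidenceVector
      (flowLattice_le_span_indicator hbin hA.subset_ground hcyc hD hDA)).trans
      (Submodule.span_le.2 hspan)
  · have haD (b : α) (hb : b ∈ A) : a ∈ D b ↔ a = b := by
      simpa [ha] using Set.ext_iff.1 (hDA b hb) a
    refine ⟨D a, ⟨hDB ⟨a, ha, rfl⟩, (haD a ha).2 rfl⟩, ?_⟩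
    rintro C ⟨hC, haC⟩
    obtain hC | ⟨b, hb, rfl⟩ := hBsub hC
    · exact absurd ha (hC.2 haC)
    · rw [(haD b hb).1 haC]

end OrientedMatroid

theorem mainTheorem8_general {α : Type u} (O : OrientedMatroid α)
    (hbin : O.underlying.IsRepresentableOver (ZMod 2)) :
    (O.IsTotallyCyclic → ∃ B : Set (Set α), O.IsDirectedCircuitBasis B) ∧
    (∀ A : Set α, O.underlying.Coindep A → (O.delete A).IsTotallyCyclic →
      ∃ B : Set (Set α), O.IsDirectedCircuitBasis B ∧ ∀ a ∈ A, ∃! C, C ∈ B ∧ a ∈ C) := by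
  refine ⟨fun hcyc => ?_, fun A hA hcyc => ?_⟩
  · obtain ⟨B, hB, -⟩ := OrientedMatroid.exists_isDirectedCircuitBasis_of_coindep hbin
      O.underlying.dual.empty_indep (O.delete_empty.symm ▸ hcyc)
    exact ⟨B, hB⟩
  · exact OrientedMatroid.exists_isDirectedCircuitBasis_of_coindep hbin hA hcyc

theorem mainTheorem8 {α : Type u} (O : OrientedMatroid α)
    (hreg : Matroid.IsRegular.{u, v} O.underlying) :
    (O.IsTotallyCyclic → ∃ B : Set (Set α), O.IsDirectedCircuitBasis B) ∧
    (∀ A : Set α, O.underlying.Coindep A → (O.delete A).IsTotallyCyclic →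
      ∃ B : Set (Set α), O.IsDirectedCircuitBasis B ∧ ∀ a ∈ A, ∃! C, C ∈ B ∧ a ∈ C) :=
  mainTheorem8_general O (isRepresentableOver_zmod_two_of_isRegular hreg)
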